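/- Let $(M,g)$ be a compact connected Hermitian manifold and $(N,h)$ a Hermitian manifold, of arbitrary complex dimensions $m$ and $n$: that is, Hausdorff complex manifolds with a smooth positive definite Hermitian form on the holomorphic tangent bundle. In a local holomorphic chart $(z^1,\dots,z^m)$ with $g_{i\bar j}=g(\partial/\partial z^i,\partial/\partial z^j)$, the curvature tensor of the Chern connection of $g$ is $$R_{i\bar jk\bar l}=-\frac{\partial^2 g_{k\bar l}}{\partial z^i\partial\bar z^j}+\sum_{p,q} g^{p\bar q}\,\frac{\partial g_{k\bar q}}{\partial z^i}\,\frac{\partial g_{p\bar l}}{\partial\bar z^j},\qquad \sum_q g^{p\bar q}g_{k\bar q}=\delta_{pk},$$ and the holomorphic sectional curvature in the direction of a nonzero holomorphic tangent vector $v=\sum_i v^i\,\partial/\partial z^i$ is $$H(v)=\frac{\sum_{i,j,k,l} R_{i\bar jk\bar l}\,v^i\overline{v^j}v^k\overline{v^l}}{g(v,v)^2}.$$ The same notions are used for $(N,h)$. The holomorphic sectional curvature is called positive (non-negative, negative, non-positive) if $H(v)>0$ ($\ge 0$, $<0$, $\le 0$) for all points and all nonzero holomorphic tangent vectors $v$ there.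 Let $f:M\to N$ be a holomorphic map. (a) If $(M,g)$ has positive and $(N,h)$ has non-positive holomorphic sectional curvature, then $f$ is constant. (b) If $(M,g)$ has non-negative and $(N,h)$ has negative holomorphic sectional curvature, then $f$ is constant. -/

import Mathlib

open scoped Manifold ContDiff

noncomputable section

/-- The model space `ℂᵐ` of complex manifolds of dimension `m`. -/
abbrev CSpace (m : ℕ) : Type := EuclideanSpace ℂ (Fin m)

/-- The Wirtinger derivative `∂u/∂zⁱ = (∂u/∂xⁱ - √-1 ∂u/∂yⁱ) / 2` at `y`,
where `zⁱ = xⁱ + √-1 yⁱ`. -/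
def wirtinger {m : ℕ} (i : Fin m) (u : CSpace m → ℂ) (y : CSpace m) : ℂ :=
  (1 / 2 : ℂ) * (fderiv ℝ u y (EuclideanSpace.single i 1)
    - Complex.I * fderiv ℝ u y (EuclideanSpace.single i Complex.I))

/-- The conjugate Wirtinger derivative `∂u/∂z̄ⁱ = (∂u/∂xⁱ + √-1 ∂u/∂yⁱ) / 2` at `y`. -/
def wirtingerBar {m : ℕ} (i : Fin m) (u : CSpace m → ℂ) (y : CSpace m) : ℂ :=
  (1 / 2 : ℂ) * (fderiv ℝ u y (EuclideanSpace.single i 1)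
    + Complex.I * fderiv ℝ u y (EuclideanSpace.single i Complex.I))

/-- The coordinate vector field `∂/∂zⁱ` of the chart `φ`, at the point with coordinates `y`.
The complex vector space `TangentSpace 𝓘(ℂ, CSpace m) x` is the holomorphic tangent space
`T'ₓM`. -/
def coordVec {m : ℕ} {M : Type*} [TopologicalSpace M] [ChartedSpace (CSpace m) M]
    (φ : OpenPartialHomeomorph M (CSpace m)) (i : Fin m) (y : CSpace m) :
    TangentSpace 𝓘(ℂ, CSpace m) (φ.symm y) :=
  mfderiv 𝓘(ℂ, CSpace m) 𝓘(ℂ, CSpace m) φ.symm y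
    (EuclideanSpace.single i (1 : ℂ) : CSpace m)

/-- The components of a tangent vector `v` at `x` in the chart `φ`: `v = ∑ᵢ vⁱ ∂/∂zⁱ`. -/
def coordComp {m : ℕ} {M : Type*} [TopologicalSpace M] [ChartedSpace (CSpace m) M]
    (φ : OpenPartialHomeomorph M (CSpace m)) (x : M)
    (v : TangentSpace 𝓘(ℂ, CSpace m) x) : CSpace m :=
  mfderiv 𝓘(ℂ, CSpace m) 𝓘(ℂ, CSpace m) φ x v

/-- A (smooth) Hermitian metric on a complex manifold `M` of dimension `m`: a positive definite
Hermitian form on each holomorphic tangent space, complex linear in the first variable and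
conjugate linear in the second one, whose components `g_{i j̄}` are `C^∞` (in the real sense)
in each chart. -/
structure HermitianMetric (m : ℕ) (M : Type*) [TopologicalSpace M]
    [ChartedSpace (CSpace m) M] where
  /-- The Hermitian form on the tangent space at `x`. -/
  form (x : M) : TangentSpace 𝓘(ℂ, CSpace m) x →ₗ[ℂ]
    TangentSpace 𝓘(ℂ, CSpace m) x →ₗ⋆[ℂ] ℂ
  conj_symm (x : M) (v w : TangentSpace 𝓘(ℂ, CSpace m) x) :
    form x w v = (starRingEnd ℂ) (form x v w)
  pos (x : M) (v : TangentSpace 𝓘(ℂ, CSpace m) x) (hv : v ≠ 0) : 0 < (form x v v).re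
  smooth (φ : OpenPartialHomeomorph M (CSpace m)) (hφ : φ ∈ atlas (CSpace m) M)
    (i j : Fin m) :
    ContDiffOn ℝ ∞ (fun y => form (φ.symm y) (coordVec φ i y) (coordVec φ j y)) φ.target

namespace HermitianMetric

variable {m : ℕ} {M : Type*} [TopologicalSpace M] [ChartedSpace (CSpace m) M]

/-- The components `g_{i j̄} = g(∂/∂zⁱ, ∂/∂zʲ)` of the metric in the chart `φ`, as functions
of the coordinates. -/
def comp (g : HermitianMetric m M) (φ : OpenPartialHomeomorph M (CSpace m))
    (i j : Fin m) (y : CSpace m) : ℂ :=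
  g.form (φ.symm y) (coordVec φ i y) (coordVec φ j y)

/-- The components `g^{p q̄}` of the inverse metric: `∑_q g^{p q̄} g_{k q̄} = δ_{p k}`.
As `g_{k q̄}` is the entry `(k, q)` of the matrix of `g`, this is the entry `(q, p)` of the
inverse matrix. -/
def invComp (g : HermitianMetric m M) (φ : OpenPartialHomeomorph M (CSpace m))
    (p q : Fin m) (y : CSpace m) : ℂ :=
  (Matrix.of fun k l : Fin m => g.comp φ k l y)⁻¹ q p

/-- The components of the curvature tensor of the Chern connection in the chart `φ`:
`R_{i j̄ k l̄} = - ∂²g_{k l̄}/∂zⁱ∂z̄ʲ + ∑_{p,q} g^{p q̄} (∂g_{k q̄}/∂zⁱ) (∂g_{p l̄}/∂z̄ʲ)`. -/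
def chernCurvature (g : HermitianMetric m M) (φ : OpenPartialHomeomorph M (CSpace m))
    (i j k l : Fin m) (y : CSpace m) : ℂ :=
  - wirtinger i (wirtingerBar j (g.comp φ k l)) y
    + ∑ p, ∑ q, g.invComp φ p q y
        * wirtinger i (g.comp φ k q) y * wirtingerBar j (g.comp φ p l) y

/-- `R(v, v̄, v, v̄) = ∑ R_{i j̄ k l̄} vⁱ v̄ʲ vᵏ v̄ˡ` for a tangent vector `v` at `x`. It is
computed in the preferred chart at `x`; since `R` is a tensor, any chart gives the same value. -/
def curvatureForm (g : HermitianMetric m M) (x : M)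
    (v : TangentSpace 𝓘(ℂ, CSpace m) x) : ℂ :=
  let φ := chartAt (CSpace m) x
  let c := coordComp φ x v
  ∑ i, ∑ j, ∑ k, ∑ l, g.chernCurvature φ i j k l (φ x)
    * c i * (starRingEnd ℂ) (c j) * c k * (starRingEnd ℂ) (c l)

/-- The holomorphic sectional curvature `H(v) = R(v, v̄, v, v̄) / g(v, v)²` in the direction of
a nonzero tangent vector `v`. (Both `R(v, v̄, v, v̄)` and `g(v, v)` are real numbers.) -/
def holSecCurv (g : HermitianMetric m M) (x : M) (v : TangentSpace 𝓘(ℂ, CSpace m) x) : ℝ :=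
  (g.curvatureForm x v).re / (g.form x v v).re ^ 2

/-- The holomorphic sectional curvature is positive. -/
def PosHSC (g : HermitianMetric m M) : Prop :=
  ∀ (x : M) (v : TangentSpace 𝓘(ℂ, CSpace m) x), v ≠ 0 → 0 < g.holSecCurv x v

/-- The holomorphic sectional curvature is non-negative. -/
def NonnegHSC (g : HermitianMetric m M) : Prop :=
  ∀ (x : M) (v : TangentSpace 𝓘(ℂ, CSpace m) x), v ≠ 0 → 0 ≤ g.holSecCurv x v

/-- The holomorphic sectional curvature is negative. -/
def NegHSC (g : HermitianMetric m M) : Prop :=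
  ∀ (x : M) (v : TangentSpace 𝓘(ℂ, CSpace m) x), v ≠ 0 → g.holSecCurv x v < 0

/-- The holomorphic sectional curvature is non-positive. -/
def NonposHSC (g : HermitianMetric m M) : Prop :=
  ∀ (x : M) (v : TangentSpace 𝓘(ℂ, CSpace m) x), v ≠ 0 → g.holSecCurv x v ≤ 0

end HermitianMetric

end

noncomputable section

open Filter Topology ComplexConjugate

/-- The real linear form `p dz + q dz̄` on `ℂ`. -/
def wirtingerForm (p q : ℂ) : ℂ →L[ℝ] ℂ :=
  p • (ContinuousLinearMap.id ℝ ℂ) + q • (Complex.conjCLE : ℂ →L[ℝ] ℂ)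

@[simp] lemma wirtingerForm_apply (p q ξ : ℂ) :
    wirtingerForm p q ξ = p * ξ + q * conj ξ := by
  simp [wirtingerForm]

/-- `u` is real differentiable at `t`, with `∂u/∂z = p` and `∂u/∂z̄ = q`. -/
def HasWirtingerAt (u : ℂ → ℂ) (p q t : ℂ) : Prop :=
  HasFDerivAt u (wirtingerForm p q) t

namespace HasWirtingerAt

variable {u v : ℂ → ℂ} {p q p' q' t : ℂ}

lemma congr_coeff (hu : HasWirtingerAt u p q t) (hp : p = p') (hq : q = q') :
    HasWirtingerAt u p' q' t :=
  hp ▸ hq ▸ hu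

lemma of_hasFDerivAt {L : ℂ →L[ℝ] ℂ} (hu : HasFDerivAt u L t)
    (hL : ∀ ξ, L ξ = p * ξ + q * conj ξ) : HasWirtingerAt u p q t := by
  have : L = wirtingerForm p q := by ext ξ; simp [hL]
  rw [this] at hu
  exact hu

lemma of_hasDerivAt (hu : HasDerivAt u p t) : HasWirtingerAt u p 0 t :=
  of_hasFDerivAt (hu.hasFDerivAt.restrictScalars ℝ) (by intro ξ; simp [mul_comm])

lemma star_comp (hu : HasWirtingerAt u p q t) :
    HasWirtingerAt (fun z => conj (u z)) (conj q) (conj p) t :=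
  of_hasFDerivAt ((Complex.conjCLE : ℂ →L[ℝ] ℂ).hasFDerivAt.comp t hu)
    (by intro ξ; simp [add_comm])

lemma add (hu : HasWirtingerAt u p q t) (hv : HasWirtingerAt v p' q' t) :
    HasWirtingerAt (fun z => u z + v z) (p + p') (q + q') t :=
  of_hasFDerivAt (HasFDerivAt.add hu hv) (by intro ξ; simp; ring)

lemma sub (hu : HasWirtingerAt u p q t) (hv : HasWirtingerAt v p' q' t) :
    HasWirtingerAt (fun z => u z - v z) (p - p') (q - q') t :=
  of_hasFDerivAt (HasFDerivAt.sub hu hv) (by intro ξ; simp; ring)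

lemma mul (hu : HasWirtingerAt u p q t) (hv : HasWirtingerAt v p' q' t) :
    HasWirtingerAt (fun z => u z * v z) (p * v t + u t * p') (q * v t + u t * q') t :=
  of_hasFDerivAt (HasFDerivAt.mul hu hv) (by intro ξ; simp; ring)

lemma const_mul (c : ℂ) (hu : HasWirtingerAt u p q t) :
    HasWirtingerAt (fun z => c * u z) (c * p) (c * q) t :=
  of_hasFDerivAt (HasFDerivAt.const_mul hu c) (by intro ξ; simp; ring)

lemma sum {ι : Type*} {s : Finset ι} {u : ι → ℂ → ℂ} {p q : ι → ℂ}
    (hu : ∀ i ∈ s, HasWirtingerAt (u i) (p i) (q i) t) :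
    HasWirtingerAt (fun z => ∑ i ∈ s, u i z) (∑ i ∈ s, p i) (∑ i ∈ s, q i) t :=
  of_hasFDerivAt (HasFDerivAt.fun_sum hu)
    (by intro ξ; simp [Finset.sum_add_distrib, Finset.sum_mul])

end HasWirtingerAt

lemma fderiv_apply_eq_sum_wirtinger {n : ℕ} (u : CSpace n → ℂ) (y ξ : CSpace n) :
    fderiv ℝ u y ξ = ∑ i, (wirtinger i u y * ξ i + wirtingerBar i u y * conj (ξ i)) := by
  have h1 : ξ = ∑ i, ((ξ i).re • (EuclideanSpace.single i 1 : CSpace n)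
      + (ξ i).im • (EuclideanSpace.single i Complex.I : CSpace n)) := by
    ext k
    simp [WithLp.ofLp_sum, Finset.sum_add_distrib, Pi.single_apply]
  conv_lhs => rw [h1]
  rw [map_sum]
  refine Finset.sum_congr rfl fun i _ => ?_
  rw [map_add, map_smul, map_smul]
  have h2 := Complex.re_add_im (ξ i)
  have h3 : conj (ξ i) = (ξ i).re - (ξ i).im * Complex.I := by
    apply Complex.ext <;> simp
  rw [h3]
  simp only [wirtinger, wirtingerBar, Complex.real_smul]
  linear_combination ((1 / 2 : ℂ) * (fderiv ℝ u y (EuclideanSpace.single i 1)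
    - Complex.I * fderiv ℝ u y (EuclideanSpace.single i Complex.I))) * h2
    + ((ξ i).im * fderiv ℝ u y (EuclideanSpace.single i Complex.I)) * Complex.I_mul_I

lemma HasWirtingerAt.comp {n : ℕ} {u : CSpace n → ℂ} {σ : ℂ → CSpace n} {σ' : CSpace n} {t : ℂ}
    (hu : DifferentiableAt ℝ u (σ t)) (hσ : HasDerivAt σ σ' t) :
    HasWirtingerAt (fun z => u (σ z)) (∑ i, wirtinger i u (σ t) * σ' i)
      (∑ i, wirtingerBar i u (σ t) * conj (σ' i)) t := by
  refine HasWirtingerAt.of_hasFDerivAt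
    (hu.hasFDerivAt.comp t (hσ.hasFDerivAt.restrictScalars ℝ)) fun ξ => ?_
  simp only [ContinuousLinearMap.comp_apply, ContinuousLinearMap.coe_restrictScalars',
    ContinuousLinearMap.toSpanSingleton_apply, fderiv_apply_eq_sum_wirtinger,
    Finset.sum_add_distrib, Finset.sum_mul, PiLp.smul_apply, smul_eq_mul, map_mul]
  congr 1 <;> refine Finset.sum_congr rfl fun i _ => ?_ <;> ring

lemma conj_wirtinger {n : ℕ} (i : Fin n) (u : CSpace n → ℂ) (y : CSpace n) :
    conj (wirtinger i u y) = wirtingerBar i (fun z => conj (u z)) y := by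
  have h : ∀ ξ, fderiv ℝ (fun z => conj (u z)) y ξ = conj (fderiv ℝ u y ξ) := by
    intro ξ
    have := Complex.conjCLE.comp_fderiv (f := u) (x := y)
    have h2 := DFunLike.congr_fun this ξ
    simpa [Function.comp_def] using h2
  have h2 : conj (2 : ℂ) = 2 := Complex.conj_ofNat 2
  simp [wirtinger, wirtingerBar, h, h2]

/-- Second derivative test along a line. -/
lemma nonneg_second_deriv_of_isLocalMin {φ ψ : ℝ → ℝ} {d : ℝ}
    (hmin : IsLocalMin φ 0) (hφ : ∀ᶠ s in 𝓝 0, HasDerivAt φ (ψ s) s)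
    (hψ : HasDerivAt ψ d 0) : 0 ≤ d := by
  by_contra! hd
  have e1 : deriv φ =ᶠ[𝓝 0] ψ := hφ.mono fun s hs => hs.deriv
  have e2 : deriv (deriv φ) 0 = d := by rw [e1.deriv_eq, hψ.deriv]
  have hmax := isLocalMax_of_deriv_deriv_neg (f := φ) (x₀ := 0) (by rw [e2]; exact hd)
    hmin.deriv_eq_zero hφ.self_of_nhds.continuousAt
  have hc : φ =ᶠ[𝓝 0] fun _ => φ 0 := by
    filter_upwards [hmin, hmax] with s h1 h2 using le_antisymm h2 h1
  have : deriv (deriv φ) 0 = 0 := by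
    rw [hc.deriv.deriv_eq]; simp
  linarith

/-- A real function on `ℂ` has non-negative `∂²F/∂z∂z̄` at a local minimum. -/
lemma nonneg_of_isLocalMin_wirtinger {F q : ℂ → ℂ} {r s : ℂ}
    (hreal : ∀ᶠ t in 𝓝 0, (F t).im = 0)
    (hmin : IsLocalMin (fun t => (F t).re) 0)
    (hF : ∀ᶠ t in 𝓝 0, ∃ p, HasWirtingerAt F p (q t) t)
    (hq : HasWirtingerAt q r s 0) : 0 ≤ r.re := by
  have key : ∀ θ : ℂ, 0 ≤ 2 * ((r * θ + s * conj θ) * conj θ).re := by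
    intro θ
    have hl : ∀ x : ℝ, HasDerivAt (fun x : ℝ => (x : ℂ) * θ) θ x := fun x => by
      simpa using (Complex.ofRealCLM.hasDerivAt (x := x)).mul_const θ
    have hl0 : Tendsto (fun x : ℝ => (x : ℂ) * θ) (𝓝 0) (𝓝 0) := by
      simpa using (hl 0).continuousAt.tendsto
    refine nonneg_second_deriv_of_isLocalMin
      (φ := fun x : ℝ => (F ((x : ℂ) * θ)).re)
      (ψ := fun x : ℝ => 2 * (q ((x : ℂ) * θ) * conj θ).re) ?_ ?_ ?_
    · have := hl0.eventually hmin
      simpa [IsLocalMin, IsMinFilter] using this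
    · filter_upwards [hl0.eventually hF, hl0.eventually hreal.eventually_nhds] with x hx hr
      obtain ⟨p, hp⟩ := hx
      have hre : HasFDerivAt (fun t => conj (F t)) (wirtingerForm p (q (x * θ))) (x * θ) := by
        refine HasFDerivAt.congr_of_eventuallyEq hp ?_
        filter_upwards [hr] with t ht
        exact Complex.conj_eq_iff_im.mpr ht
      have hpq : p = conj (q (x * θ)) := by
        have h1 := hre.unique (HasWirtingerAt.star_comp hp)
        have h2 := DFunLike.congr_fun h1 1
        have h3 := DFunLike.congr_fun h1 Complex.I
        simp only [wirtingerForm_apply, map_one, mul_one, Complex.conj_I] at h2 h3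
        have h4 : Complex.I * (p - q (x*θ)) = Complex.I * (conj (q (x*θ)) - conj p) := by
          linear_combination h3
        have h5 := mul_left_cancel₀ Complex.I_ne_zero h4
        linear_combination (h2 + h5) / 2
      have h6 := HasFDerivAt.comp_hasDerivAt (f := fun x : ℝ => (x : ℂ) * θ) (l := F)
        (l' := wirtingerForm p (q (x * θ))) x hp (hl x)
      have h7 := Complex.reCLM.hasFDerivAt.comp_hasDerivAt x h6
      refine h7.congr_deriv ?_
      simp [hpq]
      ring
    · have h6 := (HasFDerivAt.comp_hasDerivAt (f := fun x : ℝ => (x : ℂ) * θ) (0:ℝ)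
        (l := q) (l' := wirtingerForm r s) 
        (by rw [Complex.ofReal_zero, zero_mul]; exact hq) (hl 0))
      have h7 := Complex.reCLM.hasFDerivAt.comp_hasDerivAt (0:ℝ) (h6.mul_const (conj θ))
      simpa using h7.const_mul 2
  have h1 := key 1
  have h2 := key Complex.I
  simp at h1 h2
  linarith

lemma Finset.sum_sum_sum_sum_comm {ι R : Type*} [AddCommMonoid R] (s : Finset ι)
    (F : ι → ι → ι → ι → R) :
    ∑ i ∈ s, ∑ j ∈ s, ∑ k ∈ s, ∑ l ∈ s, F i j k l
      = ∑ k ∈ s, ∑ l ∈ s, ∑ j ∈ s, ∑ i ∈ s, F i j k l := by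
  rw [Finset.sum_comm]
  calc ∑ j ∈ s, ∑ i ∈ s, ∑ k ∈ s, ∑ l ∈ s, F i j k l
      = ∑ j ∈ s, ∑ k ∈ s, ∑ i ∈ s, ∑ l ∈ s, F i j k l :=
        Finset.sum_congr rfl fun j _ => Finset.sum_comm
    _ = ∑ k ∈ s, ∑ j ∈ s, ∑ i ∈ s, ∑ l ∈ s, F i j k l := Finset.sum_comm
    _ = ∑ k ∈ s, ∑ j ∈ s, ∑ l ∈ s, ∑ i ∈ s, F i j k l :=
        Finset.sum_congr rfl fun k _ => Finset.sum_congr rfl fun j _ => Finset.sum_comm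
    _ = ∑ k ∈ s, ∑ l ∈ s, ∑ j ∈ s, ∑ i ∈ s, F i j k l :=
        Finset.sum_congr rfl fun k _ => Finset.sum_comm

namespace HermitianMetric

variable {m : ℕ} {M : Type*} [TopologicalSpace M] [ChartedSpace (CSpace m) M]

/-- The Hermitian form of the metric in the coordinates of the chart `φ`. -/
def coordForm (g : HermitianMetric m M) (φ : OpenPartialHomeomorph M (CSpace m))
    (y v w : CSpace m) : ℂ :=
  ∑ k, ∑ l, g.comp φ k l y * v k * conj (w l)

/-- `∑ R_{i j̄ k l̄} vⁱ v̄ʲ vᵏ v̄ˡ` in the coordinates of the chart `φ`. -/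
def coordCurvature (g : HermitianMetric m M) (φ : OpenPartialHomeomorph M (CSpace m))
    (y v : CSpace m) : ℂ :=
  ∑ i, ∑ j, ∑ k, ∑ l, g.chernCurvature φ i j k l y * v i * conj (v j) * v k * conj (v l)

/-- The covector `∑ ∂g_{k q̄}/∂zⁱ vⁱ vᵏ`. -/
def lowerChristoffel (g : HermitianMetric m M) (φ : OpenPartialHomeomorph M (CSpace m))
    (y v : CSpace m) (q : Fin m) : ℂ :=
  ∑ k, ∑ i, wirtinger i (g.comp φ k q) y * v i * v k

/-- The vector `∑ Γᵖ_{i k} vⁱ vᵏ`, for the Christoffel symbols of the Chern connection. -/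
def christoffel (g : HermitianMetric m M) (φ : OpenPartialHomeomorph M (CSpace m))
    (y v : CSpace m) : CSpace m :=
  WithLp.toLp 2 fun p => ∑ q, g.invComp φ p q y * g.lowerChristoffel φ y v q

lemma conj_comp (g : HermitianMetric m M) (φ : OpenPartialHomeomorph M (CSpace m))
    (k l : Fin m) (y : CSpace m) : conj (g.comp φ k l y) = g.comp φ l k y :=
  (g.conj_symm _ _ _).symm

lemma conj_lowerChristoffel (g : HermitianMetric m M)
    (φ : OpenPartialHomeomorph M (CSpace m)) (y v : CSpace m) (q : Fin m) :
    conj (g.lowerChristoffel φ y v q)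
      = ∑ l, ∑ j, wirtingerBar j (g.comp φ q l) y * conj (v j) * conj (v l) := by
  simp [lowerChristoffel, map_sum, map_mul, conj_wirtinger, conj_comp]

section

variable (g : HermitianMetric m M) {φ : OpenPartialHomeomorph M (CSpace m)}

lemma contDiffAt_comp (hφ : φ ∈ atlas (CSpace m) M) (k l : Fin m) {y : CSpace m}
    (hy : y ∈ φ.target) : ContDiffAt ℝ ∞ (g.comp φ k l) y :=
  (g.smooth φ hφ k l).contDiffAt (φ.open_target.mem_nhds hy)

lemma differentiableAt_wirtingerBar_comp (hφ : φ ∈ atlas (CSpace m) M) (j k l : Fin m)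
    {y : CSpace m} (hy : y ∈ φ.target) :
    DifferentiableAt ℝ (wirtingerBar j (g.comp φ k l)) y := by
  have h : DifferentiableAt ℝ (fderiv ℝ (g.comp φ k l)) y :=
    ((g.contDiffAt_comp hφ k l hy).fderiv_right (m := 1) (by norm_cast)).differentiableAt
      one_ne_zero
  unfold wirtingerBar
  fun_prop

/-- `∂/∂z̄` of the squared length of the velocity `τ` of a holomorphic curve `σ`, where `τ'` is
the acceleration. -/
def energyBar (φ : OpenPartialHomeomorph M (CSpace m)) (σ τ τ' : ℂ → CSpace m) (t : ℂ) : ℂ :=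
  ∑ k, ∑ l, ((∑ j, wirtingerBar j (g.comp φ k l) (σ t) * conj (τ t j)) * τ t k * conj (τ t l)
    + g.comp φ k l (σ t) * τ t k * conj (τ' t l))

variable {σ τ τ' : ℂ → CSpace m} {s : CSpace m} {t : ℂ}

lemma hasDerivAt_coord {σ : ℂ → CSpace m} {s : CSpace m} {t : ℂ} (h : HasDerivAt σ s t)
    (i : Fin m) : HasDerivAt (fun z => σ z i) (s i) t :=
  (EuclideanSpace.proj (𝕜 := ℂ) i).hasFDerivAt.comp_hasDerivAt t h

lemma exists_hasWirtingerAt_coordForm (hφ : φ ∈ atlas (CSpace m) M)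
    (ht : σ t ∈ φ.target) (hσ : HasDerivAt σ (τ t) t) (hτ : HasDerivAt τ (τ' t) t) :
    ∃ p, HasWirtingerAt (fun z => g.coordForm φ (σ z) (τ z) (τ z)) p
      (g.energyBar φ σ τ τ' t) t := by
  have key : ∀ k l, ∃ p, HasWirtingerAt (fun z => g.comp φ k l (σ z) * τ z k * conj (τ z l)) p
      ((∑ j, wirtingerBar j (g.comp φ k l) (σ t) * conj (τ t j)) * τ t k * conj (τ t l)
        + g.comp φ k l (σ t) * τ t k * conj (τ' t l)) t := by
    intro k l
    have h1 := HasWirtingerAt.comp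
      ((g.contDiffAt_comp hφ k l ht).differentiableAt (by norm_num)) hσ
    have h2 := HasWirtingerAt.of_hasDerivAt (hasDerivAt_coord hτ k)
    have h3 := (HasWirtingerAt.of_hasDerivAt (hasDerivAt_coord hτ l)).star_comp
    have h4 := (h1.mul h2).mul h3
    exact ⟨_, h4.congr_coeff rfl (by ring)⟩
  choose p hp using key
  exact ⟨_, HasWirtingerAt.sum fun k _ => HasWirtingerAt.sum fun l _ => hp k l⟩

lemma exists_hasWirtingerAt_energyBar (hφ : φ ∈ atlas (CSpace m) M)
    (ht : σ t ∈ φ.target) (hσ : HasDerivAt σ (τ t) t) (hτ : HasDerivAt τ (τ' t) t)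
    (hτ' : HasDerivAt τ' s t) :
    ∃ q, HasWirtingerAt (g.energyBar φ σ τ τ')
      (∑ k, ∑ l, ((∑ j, (∑ i, wirtinger i (wirtingerBar j (g.comp φ k l)) (σ t) * τ t i)
          * conj (τ t j)) * τ t k * conj (τ t l)
        + (∑ j, wirtingerBar j (g.comp φ k l) (σ t) * conj (τ t j)) * τ' t k * conj (τ t l)
        + (∑ i, wirtinger i (g.comp φ k l) (σ t) * τ t i) * τ t k * conj (τ' t l)
        + g.comp φ k l (σ t) * τ' t k * conj (τ' t l))) q t := by
  have key : ∀ k l, ∃ q, HasWirtingerAt (fun t =>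
      (∑ j, wirtingerBar j (g.comp φ k l) (σ t) * conj (τ t j)) * τ t k * conj (τ t l)
        + g.comp φ k l (σ t) * τ t k * conj (τ' t l))
      ((∑ j, (∑ i, wirtinger i (wirtingerBar j (g.comp φ k l)) (σ t) * τ t i)
          * conj (τ t j)) * τ t k * conj (τ t l)
        + (∑ j, wirtingerBar j (g.comp φ k l) (σ t) * conj (τ t j)) * τ' t k * conj (τ t l)
        + (∑ i, wirtinger i (g.comp φ k l) (σ t) * τ t i) * τ t k * conj (τ' t l)
        + g.comp φ k l (σ t) * τ' t k * conj (τ' t l)) q t := by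
    intro k l
    have h1 := HasWirtingerAt.comp
      ((g.contDiffAt_comp hφ k l ht).differentiableAt (by norm_num)) hσ
    have hτc := fun k => HasWirtingerAt.of_hasDerivAt (hasDerivAt_coord hτ k)
    have hτ'c := fun k => HasWirtingerAt.of_hasDerivAt (hasDerivAt_coord hτ' k)
    have h2 := HasWirtingerAt.sum (s := Finset.univ) fun j _ => (HasWirtingerAt.comp
      (g.differentiableAt_wirtingerBar_comp hφ j k l ht) hσ).mul (hτc j).star_comp
    have h3 := ((h2.mul (hτc k)).mul (hτc l).star_comp).add
      ((h1.mul (hτc k)).mul (hτ'c l).star_comp)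
    exact ⟨_, h3.congr_coeff (by simp only [map_zero, mul_zero, add_zero]; ring) rfl⟩
  choose q hq using key
  exact ⟨_, HasWirtingerAt.sum fun k _ => HasWirtingerAt.sum fun l _ => hq k l⟩

end

lemma coordForm_christoffel (g : HermitianMetric m M) {φ : OpenPartialHomeomorph M (CSpace m)}
    {y : CSpace m} (hdet : IsUnit (Matrix.of fun k l : Fin m => g.comp φ k l y).det)
    (v w : CSpace m) :
    g.coordForm φ y (g.christoffel φ y v) w = ∑ l, g.lowerChristoffel φ y v l * conj (w l) := by
  have hinv : ∀ q l, ∑ k, g.invComp φ k q y * g.comp φ k l y = if q = l then 1 else 0 := by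
    intro q l
    have := congrFun (congrFun (Matrix.nonsing_inv_mul _ hdet) q) l
    simpa [Matrix.mul_apply, Matrix.one_apply, invComp] using this
  simp only [coordForm, christoffel]
  rw [Finset.sum_comm]
  refine Finset.sum_congr rfl fun l _ => ?_
  rw [← Finset.sum_mul]
  congr 1
  calc ∑ k, g.comp φ k l y * ∑ q, g.invComp φ k q y * g.lowerChristoffel φ y v q
      = ∑ q, (∑ k, g.invComp φ k q y * g.comp φ k l y) * g.lowerChristoffel φ y v q := by
        simp only [Finset.mul_sum, Finset.sum_mul]
        rw [Finset.sum_comm]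
        exact Finset.sum_congr rfl fun q _ => Finset.sum_congr rfl fun k _ => by ring
    _ = _ := by simp [hinv]

lemma coordForm_add_left (g : HermitianMetric m M) (φ : OpenPartialHomeomorph M (CSpace m))
    (y u v w : CSpace m) :
    g.coordForm φ y (u + v) w = g.coordForm φ y u w + g.coordForm φ y v w := by
  simp only [coordForm, ← Finset.sum_add_distrib]
  refine Finset.sum_congr rfl fun k _ => Finset.sum_congr rfl fun l _ => ?_
  simp; ring

lemma conj_coordForm (g : HermitianMetric m M) (φ : OpenPartialHomeomorph M (CSpace m))
    (y v w : CSpace m) :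
    conj (g.coordForm φ y v w) = g.coordForm φ y w v := by
  simp only [coordForm, map_sum, map_mul, conj_comp, Complex.conj_conj]
  rw [Finset.sum_comm]
  refine Finset.sum_congr rfl fun k _ => Finset.sum_congr rfl fun l _ => ?_
  ring

lemma coordForm_add_right (g : HermitianMetric m M) (φ : OpenPartialHomeomorph M (CSpace m))
    (y u v w : CSpace m) :
    g.coordForm φ y w (u + v) = g.coordForm φ y w u + g.coordForm φ y w v := by
  rw [← conj_coordForm, coordForm_add_left, map_add, conj_coordForm, conj_coordForm]

lemma coordCurvature_eq (g : HermitianMetric m M) {φ : OpenPartialHomeomorph M (CSpace m)}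
    {y : CSpace m} (hdet : IsUnit (Matrix.of fun k l : Fin m => g.comp φ k l y).det)
    (v : CSpace m) :
    g.coordCurvature φ y v = - (∑ k, ∑ l, (∑ j, (∑ i,
        wirtinger i (wirtingerBar j (g.comp φ k l)) y * v i) * conj (v j)) * v k * conj (v l))
      + g.coordForm φ y (g.christoffel φ y v) (g.christoffel φ y v) := by
  have e1 : ∑ i, ∑ j, ∑ k, ∑ l,
      wirtinger i (wirtingerBar j (g.comp φ k l)) y * v i * conj (v j) * v k * conj (v l)
      = ∑ k, ∑ l, (∑ j, (∑ i,
        wirtinger i (wirtingerBar j (g.comp φ k l)) y * v i) * conj (v j)) * v k * conj (v l) := by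
    simp only [Finset.sum_mul]
    rw [Finset.sum_sum_sum_sum_comm]
  have e2 : ∑ i, ∑ j, ∑ k, ∑ l, (∑ p, ∑ q, g.invComp φ p q y
        * wirtinger i (g.comp φ k q) y * wirtingerBar j (g.comp φ p l) y)
        * v i * conj (v j) * v k * conj (v l)
      = ∑ p, ∑ q, g.invComp φ p q y * g.lowerChristoffel φ y v q
        * conj (g.lowerChristoffel φ y v p) := by
    have h1 : ∀ p q, g.invComp φ p q y * g.lowerChristoffel φ y v q
        * conj (g.lowerChristoffel φ y v p) = ∑ i, ∑ j, ∑ k, ∑ l, (g.invComp φ p q y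
        * wirtinger i (g.comp φ k q) y * wirtingerBar j (g.comp φ p l) y)
        * v i * conj (v j) * v k * conj (v l) := by
      intro p q
      rw [Finset.sum_sum_sum_sum_comm, conj_lowerChristoffel, lowerChristoffel, mul_assoc,
        Finset.sum_mul_sum, Finset.mul_sum]
      refine Finset.sum_congr rfl fun k _ => ?_
      rw [Finset.mul_sum]
      refine Finset.sum_congr rfl fun l _ => ?_
      rw [mul_comm (∑ i, _), Finset.sum_mul_sum, Finset.mul_sum]
      refine Finset.sum_congr rfl fun j _ => ?_
      rw [Finset.mul_sum]
      refine Finset.sum_congr rfl fun i _ => ?_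
      ring
    simp only [h1, Finset.sum_mul]
    have h2 : ∀ F : Fin m → Fin m → Fin m → Fin m → Fin m → Fin m → ℂ,
        ∑ i, ∑ j, ∑ k, ∑ l, ∑ p, ∑ q, F i j k l p q
          = ∑ p, ∑ q, ∑ i, ∑ j, ∑ k, ∑ l, F i j k l p q := by
      intro F
      have := Finset.sum_comm (s := Finset.univ) (t := Finset.univ)
        (f := fun (x : Fin m × Fin m × Fin m × Fin m) (z : Fin m × Fin m) =>
          F x.1 x.2.1 x.2.2.1 x.2.2.2 z.1 z.2)
      simpa only [Fintype.sum_prod_type] using this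
    exact h2 _
  have e3 : g.coordForm φ y (g.christoffel φ y v) (g.christoffel φ y v)
      = ∑ p, ∑ q, g.invComp φ p q y * g.lowerChristoffel φ y v q
        * conj (g.lowerChristoffel φ y v p) := by
    rw [← conj_coordForm, coordForm_christoffel g hdet, map_sum]
    refine Finset.sum_congr rfl fun p _ => ?_
    rw [map_mul, Complex.conj_conj, mul_comm, christoffel, Finset.sum_mul]
  rw [e3, ← e1, ← e2]
  simp only [coordCurvature, chernCurvature, add_mul, Finset.sum_add_distrib, neg_mul,
    Finset.sum_neg_distrib]

/-- `∂∂̄` of the squared length of the velocity of a holomorphic curve is the curvature term plus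
the squared length of the covariant acceleration. -/
lemma exists_hasWirtingerAt_energyBar_curvature (g : HermitianMetric m M)
    {φ : OpenPartialHomeomorph M (CSpace m)} {σ τ τ' : ℂ → CSpace m} {s : CSpace m} {t : ℂ}
    (hφ : φ ∈ atlas (CSpace m) M)
    (hdet : IsUnit (Matrix.of fun k l : Fin m => g.comp φ k l (σ t)).det)
    (ht : σ t ∈ φ.target) (hσ : HasDerivAt σ (τ t) t) (hτ : HasDerivAt τ (τ' t) t)
    (hτ' : HasDerivAt τ' s t) :
    ∃ q, HasWirtingerAt (g.energyBar φ σ τ τ')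
      (- g.coordCurvature φ (σ t) (τ t)
        + g.coordForm φ (σ t) (τ' t + g.christoffel φ (σ t) (τ t))
            (τ' t + g.christoffel φ (σ t) (τ t))) q t := by
  obtain ⟨q, hq⟩ := g.exists_hasWirtingerAt_energyBar hφ ht hσ hτ hτ'
  refine ⟨q, ?_⟩
  convert hq using 1
  rw [coordCurvature_eq g hdet]
  simp only [coordForm_add_left, coordForm_add_right]
  simp only [Finset.sum_add_distrib]
  have e1 : g.coordForm φ (σ t) (g.christoffel φ (σ t) (τ t)) (τ' t) = ∑ k, ∑ l,
      (∑ i, wirtinger i (g.comp φ k l) (σ t) * τ t i) * τ t k * conj (τ' t l) := by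
    rw [coordForm_christoffel g hdet]
    simp only [lowerChristoffel, Finset.sum_mul]
    rw [Finset.sum_comm]
  have e2 : g.coordForm φ (σ t) (τ' t) (g.christoffel φ (σ t) (τ t)) = ∑ k, ∑ l,
      (∑ j, wirtingerBar j (g.comp φ k l) (σ t) * conj (τ t j)) * τ' t k * conj (τ t l) := by
    rw [← conj_coordForm, coordForm_christoffel g hdet, map_sum]
    simp only [map_mul, conj_lowerChristoffel, Complex.conj_conj, Finset.sum_mul]
    refine Finset.sum_congr rfl fun k _ => Finset.sum_congr rfl fun l _ =>
      Finset.sum_congr rfl fun j _ => ?_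
    ring
  rw [e1, e2]
  simp only [coordForm]
  ring

end HermitianMetric

/-- The set where the coordinate expression of `f` in the charts `φ`, `ψ` is defined. -/
def coordDomain {m n : ℕ} {M N : Type*} [TopologicalSpace M] [TopologicalSpace N]
    (φ : OpenPartialHomeomorph M (CSpace m)) (ψ : OpenPartialHomeomorph N (CSpace n))
    (f : M → N) : Set (CSpace m) :=
  φ.target ∩ φ.symm ⁻¹' (f ⁻¹' ψ.source)

lemma isOpen_coordDomain {m n : ℕ} {M N : Type*} [TopologicalSpace M] [TopologicalSpace N]
    {φ : OpenPartialHomeomorph M (CSpace m)} {ψ : OpenPartialHomeomorph N (CSpace n)}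
    {f : M → N} (hf : Continuous f) : IsOpen (coordDomain φ ψ f) :=
  φ.isOpen_inter_preimage_symm (ψ.open_source.preimage hf)

section Tangent

variable {m n k : ℕ} {M : Type*} [TopologicalSpace M] [ChartedSpace (CSpace m) M]
  {N : Type*} [TopologicalSpace N] [ChartedSpace (CSpace n) N]
  {P : Type*} [TopologicalSpace P] [ChartedSpace (CSpace k) P]

/-- The differential `mfderiv`, regarded as a linear map between the model spaces. -/
def modelDeriv (m n : ℕ) {M : Type*} [TopologicalSpace M] [ChartedSpace (CSpace m) M]
    {N : Type*} [TopologicalSpace N] [ChartedSpace (CSpace n) N] (f : M → N) (x : M) :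
    CSpace m →L[ℂ] CSpace n :=
  mfderiv 𝓘(ℂ, CSpace m) 𝓘(ℂ, CSpace n) f x

lemma modelDeriv_comp {f : M → N} {h : N → P} {x : M}
    (hh : MDifferentiableAt 𝓘(ℂ, CSpace n) 𝓘(ℂ, CSpace k) h (f x))
    (hf : MDifferentiableAt 𝓘(ℂ, CSpace m) 𝓘(ℂ, CSpace n) f x) (v : CSpace m) :
    modelDeriv m k (h ∘ f) x v = modelDeriv n k h (f x) (modelDeriv m n f x v) :=
  mfderiv_comp_apply x hh hf v

lemma modelDeriv_eq_fderiv (F : CSpace m → CSpace n) (y : CSpace m) :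
    modelDeriv m n F y = fderiv ℂ F y :=
  mfderiv_eq_fderiv

variable [IsManifold 𝓘(ℂ, CSpace m) ω M] [IsManifold 𝓘(ℂ, CSpace n) ω N]
  {φ : OpenPartialHomeomorph M (CSpace m)} {ψ : OpenPartialHomeomorph N (CSpace n)}

lemma mdifferentiable_chart_of_mem (hφ : φ ∈ atlas (CSpace m) M) :
    φ.MDifferentiable 𝓘(ℂ, CSpace m) 𝓘(ℂ, CSpace m) :=
  haveI : IsManifold 𝓘(ℂ, CSpace m) 1 M := IsManifold.of_le (n := ω) le_top
  mdifferentiable_of_mem_atlas hφ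

lemma modelDeriv_symm_apply (hφ : φ ∈ atlas (CSpace m) M) {x : M} (hx : x ∈ φ.source)
    (v : CSpace m) : modelDeriv m m φ.symm (φ x) (modelDeriv m m φ x v) = v :=
  DFunLike.congr_fun ((mdifferentiable_chart_of_mem hφ).symm_comp_deriv hx) v

lemma modelDeriv_apply_symm (hφ : φ ∈ atlas (CSpace m) M) {y : CSpace m} (hy : y ∈ φ.target)
    (v : CSpace m) : modelDeriv m m φ (φ.symm y) (modelDeriv m m φ.symm y v) = v :=
  DFunLike.congr_fun ((mdifferentiable_chart_of_mem hφ).comp_symm_deriv hy) v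

lemma modelDeriv_symm_ne_zero (hφ : φ ∈ atlas (CSpace m) M) {y : CSpace m} (hy : y ∈ φ.target)
    {v : CSpace m} (hv : v ≠ 0) : modelDeriv m m φ.symm y v ≠ 0 := fun h => hv <| by
  rw [← modelDeriv_apply_symm hφ hy v, h, map_zero]

variable {f : M → N}

lemma differentiableAt_coord (hf : MDifferentiable 𝓘(ℂ, CSpace m) 𝓘(ℂ, CSpace n) f)
    (hφ : φ ∈ atlas (CSpace m) M) (hψ : ψ ∈ atlas (CSpace n) N)
    {y : CSpace m} (hy : y ∈ coordDomain φ ψ f) :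
    DifferentiableAt ℂ (ψ ∘ f ∘ φ.symm) y :=
  mdifferentiableAt_iff_differentiableAt.mp <|
    ((mdifferentiable_chart_of_mem hψ).mdifferentiableAt hy.2).comp y
      ((hf _).comp y ((mdifferentiable_chart_of_mem hφ).mdifferentiableAt_symm hy.1))

lemma fderiv_coord_apply (hf : MDifferentiable 𝓘(ℂ, CSpace m) 𝓘(ℂ, CSpace n) f)
    (hφ : φ ∈ atlas (CSpace m) M) (hψ : ψ ∈ atlas (CSpace n) N)
    {y : CSpace m} (hy : y ∈ coordDomain φ ψ f) (v : CSpace m) :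
    fderiv ℂ (ψ ∘ f ∘ φ.symm) y v = modelDeriv n n ψ (f (φ.symm y))
      (modelDeriv m n f (φ.symm y) (modelDeriv m m φ.symm y v)) := by
  have h1 := (mdifferentiable_chart_of_mem hφ).mdifferentiableAt_symm hy.1
  rw [← modelDeriv_eq_fderiv, modelDeriv_comp (f := f ∘ φ.symm) (x := y)
    ((mdifferentiable_chart_of_mem hψ).mdifferentiableAt hy.2) ((hf _).comp y h1),
    modelDeriv_comp (hf _) h1]
  rfl

end Tangent

/-- A complex differentiable map on an open set of a finite-dimensional space has a continuous
derivative. -/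
lemma DifferentiableOn.continuousOn_fderiv_of_isOpen {E E' : Type*}
    [NormedAddCommGroup E] [NormedSpace ℂ E] [ProperSpace E]
    [NormedAddCommGroup E'] [NormedSpace ℂ E'] {F : E → E'} {U : Set E}
    (hF : DifferentiableOn ℂ F U) (hU : IsOpen U) : ContinuousOn (fderiv ℂ F) U := by
  intro y₀ hy₀
  refine ContinuousAt.continuousWithinAt ?_
  obtain ⟨R, hR, hRU⟩ := Metric.isOpen_iff.mp hU y₀ hy₀
  set r := R / 3 with hr
  have hr0 : 0 < r := by positivity
  have hsub : Metric.closedBall y₀ (2 * r) ⊆ U :=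
    (Metric.closedBall_subset_ball (by rw [hr]; linarith)).trans hRU
  have huc : UniformContinuousOn F (Metric.closedBall y₀ (2 * r)) :=
    (isCompact_closedBall y₀ (2 * r)).uniformContinuousOn_of_continuous
      (hF.continuousOn.mono hsub)
  rw [Metric.continuousAt_iff]
  intro ε hε
  obtain ⟨δ, hδ, hδF⟩ := Metric.uniformContinuousOn_iff.mp huc (ε / 2 * r) (by positivity)
  refine ⟨min δ r, by positivity, fun {y} hy => ?_⟩
  rw [lt_min_iff] at hy
  rw [dist_eq_norm]
  refine lt_of_le_of_lt ?_ (half_lt_self hε)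
  refine ContinuousLinearMap.opNorm_le_of_unit_norm (𝕜 := ℂ) (by positivity) fun e he => ?_
  have hmem : ∀ z : E, z ∈ Metric.ball y₀ r → ∀ t : ℂ, t ∈ Metric.closedBall (0 : ℂ) r →
      z + t • e ∈ Metric.closedBall y₀ (2 * r) := by
    intro z hz t ht
    rw [mem_closedBall_zero_iff] at ht
    rw [Metric.mem_closedBall, dist_eq_norm, add_sub_right_comm]
    rw [Metric.mem_ball, dist_eq_norm] at hz
    calc ‖z - y₀ + t • e‖ ≤ ‖z - y₀‖ + ‖t • e‖ := norm_add_le _ _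
      _ ≤ r + r := by rw [norm_smul, he, mul_one]; gcongr
      _ = 2 * r := by ring
  have hder : ∀ z : E, z ∈ Metric.ball y₀ r → ∀ t : ℂ, t ∈ Metric.closedBall (0 : ℂ) r →
      HasDerivAt (fun t : ℂ => F (z + t • e)) (fderiv ℂ F (z + t • e) e) t := by
    intro z hz t ht
    have h1 := (hF.differentiableAt (hU.mem_nhds (hsub (hmem z hz t ht)))).hasFDerivAt
    have h2 : HasDerivAt (fun t : ℂ => z + t • e) e t := by
      simpa using ((hasDerivAt_id t).smul_const e).const_add z
    exact h1.comp_hasDerivAt t h2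
  have h0 : (0 : ℂ) ∈ Metric.closedBall (0 : ℂ) r := by simp [hr0.le]
  have hy₀r : y₀ ∈ Metric.ball y₀ r := Metric.mem_ball_self hr0
  have hd : ∀ t ∈ Metric.closedBall (0 : ℂ) r,
      HasDerivAt (fun t : ℂ => F (y + t • e) - F (y₀ + t • e))
        (fderiv ℂ F (y + t • e) e - fderiv ℂ F (y₀ + t • e) e) t := fun t ht =>
    (hder y hy.2 t ht).sub (hder y₀ hy₀r t ht)
  have hcl : DiffContOnCl ℂ (fun t : ℂ => F (y + t • e) - F (y₀ + t • e))
      (Metric.ball 0 r) := by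
    refine DifferentiableOn.diffContOnCl fun t ht => ?_
    rw [closure_ball _ hr0.ne'] at ht
    exact (hd t ht).differentiableAt.differentiableWithinAt
  have hb := Complex.norm_deriv_le_of_forall_mem_sphere_norm_le (C := ε / 2 * r) hr0 hcl
    fun t ht => by
      have ht' := Metric.sphere_subset_closedBall ht
      rw [← dist_eq_norm]
      refine (hδF _ (hmem y hy.2 t ht') _ (hmem y₀ hy₀r t ht') ?_).le
      simpa using hy.1
  rw [(hd 0 h0).deriv, mul_div_assoc, div_self hr0.ne', mul_one] at hb
  simpa using hb

namespace HermitianMetric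

section Basic

variable {m : ℕ} {M : Type*} [TopologicalSpace M] [ChartedSpace (CSpace m) M]

/-- The squared length of a tangent vector. -/
def lenSq (g : HermitianMetric m M) (x : M) (v : CSpace m) : ℝ :=
  (g.form x (show TangentSpace 𝓘(ℂ, CSpace m) x from v)
    (show TangentSpace 𝓘(ℂ, CSpace m) x from v)).re

lemma lenSq_pos (g : HermitianMetric m M) (x : M) {v : CSpace m} (hv : v ≠ 0) :
    0 < g.lenSq x v :=
  g.pos x v hv

@[simp] lemma lenSq_zero (g : HermitianMetric m M) (x : M) : g.lenSq x 0 = 0 := by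
  have h : (g.form x (0 : TangentSpace 𝓘(ℂ, CSpace m) x)
    (0 : TangentSpace 𝓘(ℂ, CSpace m) x)).re = 0 := by rw [map_zero]; simp
  exact h

lemma lenSq_nonneg (g : HermitianMetric m M) (x : M) (v : CSpace m) : 0 ≤ g.lenSq x v := by
  rcases eq_or_ne v 0 with rfl | hv
  · simp
  · exact (g.lenSq_pos x hv).le

lemma form_smul_smul (g : HermitianMetric m M) (x : M) (c : ℝ)
    (v : TangentSpace 𝓘(ℂ, CSpace m) x) :
    g.form x ((c : ℂ) • v) ((c : ℂ) • v) = ((c ^ 2 : ℝ) : ℂ) * g.form x v v := by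
  rw [(g.form x).map_smul, LinearMap.smul_apply, LinearMap.map_smulₛₗ]
  simp only [Complex.conj_ofReal, smul_eq_mul]
  push_cast; ring

lemma lenSq_smul (g : HermitianMetric m M) (x : M) (c : ℝ) (v : CSpace m) :
    g.lenSq x ((c : ℂ) • v) = c ^ 2 * g.lenSq x v := by
  have h := congrArg Complex.re (g.form_smul_smul x c v)
  rw [Complex.re_ofReal_mul] at h
  exact h

lemma coordForm_eq_form (g : HermitianMetric m M) (φ : OpenPartialHomeomorph M (CSpace m))
    (y v w : CSpace m) :
    g.coordForm φ y v w = g.form (φ.symm y)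
      (mfderiv 𝓘(ℂ, CSpace m) 𝓘(ℂ, CSpace m) φ.symm y v)
      (mfderiv 𝓘(ℂ, CSpace m) 𝓘(ℂ, CSpace m) φ.symm y w) := by
  have h : ∀ v : CSpace m, mfderiv 𝓘(ℂ, CSpace m) 𝓘(ℂ, CSpace m) φ.symm y v
      = ∑ i, v i • coordVec φ i y := by
    intro v
    have hv : v = ∑ i, v i • (EuclideanSpace.single i 1 : CSpace m) := by
      ext k
      simp [WithLp.ofLp_sum, Pi.single_apply]
    have h1 : modelDeriv m m φ.symm y v
        = ∑ i, v i • modelDeriv m m φ.symm y (EuclideanSpace.single i 1 : CSpace m) := by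
      conv_lhs => rw [hv]
      simp only [map_sum, map_smul]
    exact h1
  rw [h v, h w, map_sum (g.form (φ.symm y)), LinearMap.sum_apply]
  refine Finset.sum_congr rfl fun k _ => ?_
  rw [map_sum]
  refine Finset.sum_congr rfl fun l _ => ?_
  rw [(g.form (φ.symm y)).map_smul, LinearMap.smul_apply, LinearMap.map_smulₛₗ]
  simp only [smul_eq_mul, comp]
  ring

lemma re_coordForm (g : HermitianMetric m M) (φ : OpenPartialHomeomorph M (CSpace m))
    (y v : CSpace m) :
    (g.coordForm φ y v v).re = g.lenSq (φ.symm y) (modelDeriv m m φ.symm y v) := by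
  rw [coordForm_eq_form]; rfl

lemma im_coordForm (g : HermitianMetric m M) (φ : OpenPartialHomeomorph M (CSpace m))
    (y v : CSpace m) : (g.coordForm φ y v v).im = 0 :=
  Complex.conj_eq_iff_im.mp (g.conj_coordForm φ y v v)

lemma re_coordForm_smul (g : HermitianMetric m M) (φ : OpenPartialHomeomorph M (CSpace m))
    (y v : CSpace m) (c : ℝ) :
    (g.coordForm φ y ((c : ℂ) • v) ((c : ℂ) • v)).re = c ^ 2 * (g.coordForm φ y v v).re := by
  simp only [re_coordForm, map_smul, lenSq_smul]

variable [IsManifold 𝓘(ℂ, CSpace m) ω M]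

lemma isUnit_det_comp (g : HermitianMetric m M) {φ : OpenPartialHomeomorph M (CSpace m)}
    (hφ : φ ∈ atlas (CSpace m) M) {y : CSpace m} (hy : y ∈ φ.target) :
    IsUnit (Matrix.of fun k l : Fin m => g.comp φ k l y).det := by
  rw [isUnit_iff_ne_zero]
  intro hdet
  obtain ⟨v, hv, hv0⟩ := Matrix.exists_vecMul_eq_zero_iff.mpr hdet
  have h1 : g.coordForm φ y (WithLp.toLp 2 v) (WithLp.toLp 2 v) = 0 := by
    simp only [coordForm]
    rw [Finset.sum_comm]
    refine Finset.sum_eq_zero fun l _ => ?_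
    rw [← Finset.sum_mul]
    have := congrFun hv0 l
    simp only [Matrix.vecMul, dotProduct, Matrix.of_apply, Pi.zero_apply] at this
    simp only [mul_comm (g.comp φ _ l y)]
    rw [this, zero_mul]
  have h2 : (WithLp.toLp 2 v : CSpace m) ≠ 0 := fun h => hv (by
    have := congrArg WithLp.ofLp h
    simpa using this)
  have h3 := g.re_coordForm φ y (WithLp.toLp 2 v)
  rw [h1] at h3
  exact (g.lenSq_pos _ (modelDeriv_symm_ne_zero hφ hy h2)).ne h3

lemma re_coordForm_pos (g : HermitianMetric m M) {φ : OpenPartialHomeomorph M (CSpace m)}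
    (hφ : φ ∈ atlas (CSpace m) M) {y : CSpace m} (hy : y ∈ φ.target) {v : CSpace m}
    (hv : v ≠ 0) : 0 < (g.coordForm φ y v v).re := by
  rw [re_coordForm]
  exact g.lenSq_pos _ (modelDeriv_symm_ne_zero hφ hy hv)

end Basic

section Compare

variable {m n : ℕ} {M : Type*} [TopologicalSpace M] [ChartedSpace (CSpace m) M]
  [IsManifold 𝓘(ℂ, CSpace m) ω M]
  {N : Type*} [TopologicalSpace N] [ChartedSpace (CSpace n) N] [IsManifold 𝓘(ℂ, CSpace n) ω N]

/-- Maximum principle: if the distortion of the holomorphic map `F` is maximal in the direction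
`c` at `y₀`, then the curvatures in the directions `c` and `DF c` are compared. -/
lemma coordCurvature_le_of_isMax (g : HermitianMetric m M) (h : HermitianMetric n N)
    {φ : OpenPartialHomeomorph M (CSpace m)} {ψ : OpenPartialHomeomorph N (CSpace n)}
    (hφ : φ ∈ atlas (CSpace m) M) (hψ : ψ ∈ atlas (CSpace n) N)
    {F : CSpace m → CSpace n} {U : Set (CSpace m)} (hU : IsOpen U) (hUφ : U ⊆ φ.target)
    (hF : DifferentiableOn ℂ F U) (hFU : Set.MapsTo F U ψ.target)
    {y₀ c : CSpace m} (hy₀ : y₀ ∈ U) {C : ℝ}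
    (hle : ∀ y ∈ U, ∀ v, (h.coordForm ψ (F y) (fderiv ℂ F y v) (fderiv ℂ F y v)).re
      ≤ C * (g.coordForm φ y v v).re)
    (heq : (h.coordForm ψ (F y₀) (fderiv ℂ F y₀ c) (fderiv ℂ F y₀ c)).re
      = C * (g.coordForm φ y₀ c c).re) :
    C * (g.coordCurvature φ y₀ c).re ≤ (h.coordCurvature ψ (F y₀) (fderiv ℂ F y₀ c)).re := by
  set a : CSpace m := - g.christoffel φ y₀ c with ha
  set γ : ℂ → CSpace m := fun t => y₀ + t • c + (t ^ 2 / 2) • a with hγ_def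
  set γ' : ℂ → CSpace m := fun t => c + t • a with hγ'_def
  have hγ : ∀ t, HasDerivAt γ (γ' t) t := by
    intro t
    have h1 := ((hasDerivAt_id t).smul_const c).const_add y₀
    have h2 := (((hasDerivAt_id t).pow 2).div_const 2).smul_const a
    refine (h1.add h2).congr_deriv ?_
    simp [hγ'_def]
  have hγ' : ∀ t, HasDerivAt γ' a t := by
    intro t
    refine (((hasDerivAt_id t).smul_const a).const_add c).congr_deriv ?_
    simp
  have hγ0 : γ 0 = y₀ := by simp [hγ_def]
  have hγ'0 : γ' 0 = c := by simp [hγ'_def]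
  have hγc : Continuous γ := continuous_iff_continuousAt.mpr fun t => (hγ t).continuousAt
  set V : Set ℂ := γ ⁻¹' U
  have hV : IsOpen V := hU.preimage hγc
  have h0V : (0 : ℂ) ∈ V := by simpa [V, hγ0] using hy₀
  set σ : ℂ → CSpace n := F ∘ γ
  have hσd : ∀ t ∈ V, HasDerivAt σ (fderiv ℂ F (γ t) (γ' t)) t := fun t ht =>
    (hF.differentiableAt (hU.mem_nhds ht)).hasFDerivAt.comp_hasDerivAt t (hγ t)
  have hσV : DifferentiableOn ℂ σ V := fun t ht =>
    (hσd t ht).differentiableAt.differentiableWithinAt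
  have hτV := hσV.deriv hV
  have hτ'V := hτV.deriv hV
  have hVn : ∀ᶠ t in 𝓝 (0 : ℂ), t ∈ V := hV.mem_nhds h0V
  have hD : ∀ {G : ℂ → CSpace n}, DifferentiableOn ℂ G V → ∀ t ∈ V, HasDerivAt G (deriv G t) t :=
    fun hG t ht => (hG.differentiableAt (hV.mem_nhds ht)).hasDerivAt
  have hder : ∀ t ∈ V, deriv σ t = fderiv ℂ F (γ t) (γ' t) := fun t ht => (hσd t ht).deriv
  obtain ⟨s₁, hs₁⟩ := g.exists_hasWirtingerAt_energyBar_curvature (τ' := fun _ => a)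
    (s := 0) hφ (g.isUnit_det_comp hφ (hUφ h0V)) (hUφ h0V) (hγ 0) (hγ' 0) (hasDerivAt_const _ _)
  obtain ⟨s₂, hs₂⟩ := h.exists_hasWirtingerAt_energyBar_curvature
    hψ (h.isUnit_det_comp hψ (hFU h0V)) (hFU h0V) (hD hσV 0 h0V) (hD hτV 0 h0V) (hD hτ'V 0 h0V)
  have key := nonneg_of_isLocalMin_wirtinger
    (F := fun t => C * g.coordForm φ (γ t) (γ' t) (γ' t)
      - h.coordForm ψ (σ t) (deriv σ t) (deriv σ t))
    (Eventually.of_forall fun t => by simp [im_coordForm]) ?_ ?_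
    ((hs₁.const_mul (C : ℂ)).sub hs₂)
  · have hpos := h.lenSq_nonneg (ψ.symm (σ 0)) (modelDeriv n n ψ.symm (σ 0)
      (deriv (deriv σ) 0 + h.christoffel ψ (σ 0) (deriv σ 0)))
    rw [← re_coordForm] at hpos
    have hz : g.coordForm φ y₀ 0 0 = 0 := by simp [coordForm]
    have hσ0 : σ 0 = F y₀ := by simp [σ, hγ0]
    have hd0 := hder 0 h0V
    rw [hγ0, hγ'0] at hd0
    simp only [hγ0, hγ'0, hσ0, hd0, ha, neg_add_cancel, hz, add_zero] at key hpos
    simp only [Complex.sub_re, Complex.add_re, Complex.neg_re, Complex.re_ofReal_mul] at key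
    linarith
  · have hd0 := hder 0 h0V
    filter_upwards [hVn] with t ht
    have h1 := hle (γ t) ht (γ' t)
    simp only [Complex.sub_re, Complex.re_ofReal_mul, hder t ht, hd0, hγ0, hγ'0, σ,
      Function.comp_apply, heq, sub_self]
    linarith
  · filter_upwards [hVn] with t ht
    obtain ⟨p₁, hp₁⟩ := g.exists_hasWirtingerAt_coordForm (τ' := fun _ => a) hφ (hUφ ht) (hγ t)
      (hγ' t)
    obtain ⟨p₂, hp₂⟩ := h.exists_hasWirtingerAt_coordForm hψ (hFU ht) (hD hσV t ht)
      (hD hτV t ht)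
    exact ⟨_, (hp₁.const_mul (C : ℂ)).sub hp₂⟩

variable {f : M → N}

lemma re_coordForm_fderiv_coord (h : HermitianMetric n N)
    (hf : MDifferentiable 𝓘(ℂ, CSpace m) 𝓘(ℂ, CSpace n) f)
    {φ : OpenPartialHomeomorph M (CSpace m)} {ψ : OpenPartialHomeomorph N (CSpace n)}
    (hφ : φ ∈ atlas (CSpace m) M) (hψ : ψ ∈ atlas (CSpace n) N)
    {y : CSpace m} (hy : y ∈ coordDomain φ ψ f) (v : CSpace m) :
    (h.coordForm ψ ((ψ ∘ f ∘ φ.symm) y) (fderiv ℂ (ψ ∘ f ∘ φ.symm) y v)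
      (fderiv ℂ (ψ ∘ f ∘ φ.symm) y v)).re
      = h.lenSq (f (φ.symm y)) (modelDeriv m n f (φ.symm y) (modelDeriv m m φ.symm y v)) := by
  rw [re_coordForm, fderiv_coord_apply hf hφ hψ hy]
  simp only [Function.comp_apply]
  rw [modelDeriv_symm_apply hψ hy.2, ψ.left_inv hy.2]

/-- The distortion of a holomorphic map is bounded near each point by its value at one tangent
vector. -/
lemma exists_local_max_distortion (g : HermitianMetric m M) (h : HermitianMetric n N)
    (hf : MDifferentiable 𝓘(ℂ, CSpace m) 𝓘(ℂ, CSpace n) f) (hm : 0 < m) (x₀ : M) :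
    ∃ t ∈ 𝓝 x₀, ∃ (x : M) (v : CSpace m), v ≠ 0 ∧ ∀ y ∈ t, ∀ w,
      h.lenSq (f y) (modelDeriv m n f y w) * g.lenSq x v
        ≤ h.lenSq (f x) (modelDeriv m n f x v) * g.lenSq y w := by
  set φ := chartAt (CSpace m) x₀
  set ψ := chartAt (CSpace n) (f x₀)
  have hφ : φ ∈ atlas (CSpace m) M := chart_mem_atlas _ _
  have hψ : ψ ∈ atlas (CSpace n) N := chart_mem_atlas _ _
  set F : CSpace m → CSpace n := ψ ∘ f ∘ φ.symm
  set U := coordDomain φ ψ f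
  have hU : IsOpen U := isOpen_coordDomain hf.continuous
  have hF : DifferentiableOn ℂ F U := fun y hy =>
    (differentiableAt_coord hf hφ hψ hy).differentiableWithinAt
  have hx₀ : x₀ ∈ φ.source := mem_chart_source _ _
  have hx₀U : φ x₀ ∈ U := by
    refine ⟨φ.map_source hx₀, ?_⟩
    simp only [Set.mem_preimage, φ.left_inv hx₀]
    exact mem_chart_source _ _
  obtain ⟨r, hr, hrU⟩ := Metric.nhds_basis_closedBall.mem_iff.mp (hU.mem_nhds hx₀U)
  set K := Metric.closedBall (φ x₀) r
  have hne : (Metric.sphere (0 : CSpace m) 1).Nonempty :=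
    ⟨EuclideanSpace.single ⟨0, hm⟩ 1, by simp⟩
  have hFU : Set.MapsTo F U ψ.target := fun y hy => ψ.map_source hy.2
  have hcont : ContinuousOn (fun z : CSpace m × CSpace m =>
      (h.coordForm ψ (F z.1) (fderiv ℂ F z.1 z.2) (fderiv ℂ F z.1 z.2)).re
        / (g.coordForm φ z.1 z.2 z.2).re) (K ×ˢ Metric.sphere (0 : CSpace m) 1) := by
    have hK1 : Set.MapsTo (Prod.fst : CSpace m × CSpace m → CSpace m)
      (K ×ˢ Metric.sphere (0 : CSpace m) 1) U := fun z hz => hrU hz.1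
    have hDF : ContinuousOn (fun z : CSpace m × CSpace m => fderiv ℂ F z.1 z.2)
        (K ×ˢ Metric.sphere (0 : CSpace m) 1) :=
      ((hF.continuousOn_fderiv_of_isOpen hU).comp continuousOn_fst hK1).clm_apply
        continuousOn_snd
    have hFc : ContinuousOn (fun z : CSpace m × CSpace m => F z.1)
        (K ×ˢ Metric.sphere (0 : CSpace m) 1) := hF.continuousOn.comp continuousOn_fst hK1
    have hcoord : ∀ {k : ℕ} {G : CSpace m × CSpace m → CSpace k} {s},
        ContinuousOn G s → ∀ i, ContinuousOn (fun z => G z i) s := fun hG i =>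
      (EuclideanSpace.proj (𝕜 := ℂ) i).continuous.comp_continuousOn hG
    refine ContinuousOn.div ?_ ?_ fun z hz => (g.re_coordForm_pos hφ (hrU hz.1).1 ?_).ne'
    · refine Complex.continuous_re.comp_continuousOn ?_
      refine continuousOn_finsetSum _ fun k _ => continuousOn_finsetSum _ fun l _ => ?_
      exact (((h.smooth ψ hψ k l).continuousOn.comp hFc (hFU.comp hK1)).mul (hcoord hDF k)).mul
        (Complex.continuous_conj.comp_continuousOn (hcoord hDF l))
    · refine Complex.continuous_re.comp_continuousOn ?_
      refine continuousOn_finsetSum _ fun k _ => continuousOn_finsetSum _ fun l _ => ?_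
      exact (((g.smooth φ hφ k l).continuousOn.comp continuousOn_fst
        (fun z hz => (hK1 hz).1)).mul (hcoord continuousOn_snd k)).mul
        (Complex.continuous_conj.comp_continuousOn (hcoord continuousOn_snd l))
    · exact ne_zero_of_mem_unit_sphere ⟨z.2, hz.2⟩
  obtain ⟨z, hz, hzmax⟩ := ((isCompact_closedBall (φ x₀) r).prod
    (isCompact_sphere (0 : CSpace m) 1)).exists_isMaxOn
    ((Metric.nonempty_closedBall.mpr hr.le).prod hne) hcont
  have hz0 : z.2 ≠ 0 := ne_zero_of_mem_unit_sphere ⟨z.2, hz.2⟩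
  refine ⟨φ.source ∩ φ ⁻¹' K, inter_mem (φ.open_source.mem_nhds hx₀)
    ((φ.continuousAt hx₀).preimage_mem_nhds (Metric.closedBall_mem_nhds _ hr)),
    φ.symm z.1, modelDeriv m m φ.symm z.1 z.2,
    modelDeriv_symm_ne_zero hφ (hrU hz.1).1 hz0, ?_⟩
  rintro y ⟨hy, hyK⟩ w
  rcases eq_or_ne w 0 with rfl | hw
  · simp
  set u := modelDeriv m m φ y w
  have hu : modelDeriv m m φ.symm (φ y) u = w := modelDeriv_symm_apply hφ hy w
  have hu0 : u ≠ 0 := by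
    intro h0
    rw [h0, map_zero] at hu
    exact hw hu.symm
  have hun : ‖u‖ ≠ 0 := norm_ne_zero_iff.mpr hu0
  set e : CSpace m := ((‖u‖⁻¹ : ℝ) : ℂ) • u
  have he : e ∈ Metric.sphere (0 : CSpace m) 1 := by
    rw [mem_sphere_zero_iff_norm, norm_smul, Complex.norm_real, norm_inv, norm_norm,
      inv_mul_cancel₀ hun]
  have hmax := hzmax (show (φ y, e) ∈ K ×ˢ Metric.sphere (0 : CSpace m) 1 from ⟨hyK, he⟩)
  simp only [Set.mem_ofPred_eq, e, map_smul, re_coordForm_smul] at hmax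
  rw [mul_div_mul_left _ _ (pow_ne_zero 2 (inv_ne_zero hun)),
    div_le_div_iff₀ (g.re_coordForm_pos hφ (hrU hyK).1 hu0)
      (g.re_coordForm_pos hφ (hrU hz.1).1 hz0),
    h.re_coordForm_fderiv_coord hf hφ hψ (hrU hyK),
    h.re_coordForm_fderiv_coord hf hφ hψ (hrU hz.1), re_coordForm, re_coordForm,
    φ.left_inv hy, hu] at hmax
  exact hmax

/-- The distortion of a holomorphic map on a compact manifold is maximal at some tangent vector. -/
lemma exists_max_distortion [CompactSpace M] [Nonempty M] (g : HermitianMetric m M)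
    (h : HermitianMetric n N)
    (hf : MDifferentiable 𝓘(ℂ, CSpace m) 𝓘(ℂ, CSpace n) f) (hm : 0 < m) :
    ∃ (x : M) (v : CSpace m), v ≠ 0 ∧ ∀ y w,
      h.lenSq (f y) (modelDeriv m n f y w) * g.lenSq x v
        ≤ h.lenSq (f x) (modelDeriv m n f x v) * g.lenSq y w := by
  have key := isCompact_univ.induction_on (X := M)
    (p := fun t => ∃ (x : M) (v : CSpace m), v ≠ 0 ∧ ∀ y ∈ t, ∀ w,
      h.lenSq (f y) (modelDeriv m n f y w) * g.lenSq x v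
        ≤ h.lenSq (f x) (modelDeriv m n f x v) * g.lenSq y w)
    ⟨Classical.arbitrary M, EuclideanSpace.single ⟨0, hm⟩ 1, by simp, by simp⟩
    (fun s t hst ⟨x, v, hv, H⟩ => ⟨x, v, hv, fun y hy => H y (hst hy)⟩) ?_
    fun x _ => by
      rw [nhdsWithin_univ]
      exact g.exists_local_max_distortion h hf hm x
  · obtain ⟨x, v, hv, H⟩ := key
    exact ⟨x, v, hv, fun y => H y trivial⟩
  · have trans : ∀ {x₁ x₂ y : M} {v₁ v₂ w : CSpace m}, v₁ ≠ 0 →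
        h.lenSq (f y) (modelDeriv m n f y w) * g.lenSq x₁ v₁
          ≤ h.lenSq (f x₁) (modelDeriv m n f x₁ v₁) * g.lenSq y w →
        h.lenSq (f x₁) (modelDeriv m n f x₁ v₁) * g.lenSq x₂ v₂
          ≤ h.lenSq (f x₂) (modelDeriv m n f x₂ v₂) * g.lenSq x₁ v₁ →
        h.lenSq (f y) (modelDeriv m n f y w) * g.lenSq x₂ v₂
          ≤ h.lenSq (f x₂) (modelDeriv m n f x₂ v₂) * g.lenSq y w := by
      intro x₁ x₂ y v₁ v₂ w hv₁ h1 h2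
      have p1 := g.lenSq_pos x₁ hv₁
      refine le_of_mul_le_mul_right ?_ p1
      have h3 := mul_le_mul_of_nonneg_right h1 (g.lenSq_nonneg x₂ v₂)
      have h4 := mul_le_mul_of_nonneg_right h2 (g.lenSq_nonneg y w)
      linarith
    rintro s t ⟨x₁, v₁, hv₁, H₁⟩ ⟨x₂, v₂, hv₂, H₂⟩
    rcases le_total (h.lenSq (f x₁) (modelDeriv m n f x₁ v₁) * g.lenSq x₂ v₂)
      (h.lenSq (f x₂) (modelDeriv m n f x₂ v₂) * g.lenSq x₁ v₁) with hle | hle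
    · exact ⟨x₂, v₂, hv₂, fun y hy w => hy.elim (fun hy => trans hv₁ (H₁ y hy w) hle)
        fun hy => H₂ y hy w⟩
    · exact ⟨x₁, v₁, hv₁, fun y hy w => hy.elim (fun hy => H₁ y hy w)
        fun hy => trans hv₂ (H₂ y hy w) hle⟩

end Compare

end HermitianMetric

section Constant

variable {m n : ℕ} {M : Type*} [TopologicalSpace M] [ChartedSpace (CSpace m) M]
  [IsManifold 𝓘(ℂ, CSpace m) ω M]
  {N : Type*} [TopologicalSpace N] [ChartedSpace (CSpace n) N] [IsManifold 𝓘(ℂ, CSpace n) ω N]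
  {f : M → N}

/-- A map with vanishing differential on a connected complex manifold is constant. -/
lemma exists_forall_eq_of_modelDeriv_eq_zero [ConnectedSpace M]
    (hf : MDifferentiable 𝓘(ℂ, CSpace m) 𝓘(ℂ, CSpace n) f)
    (h0 : ∀ x, modelDeriv m n f x = 0) : ∃ c, ∀ x, f x = c := by
  have hloc : IsLocallyConstant f := by
    rw [IsLocallyConstant.iff_eventually_eq]
    intro x₀
    set φ := chartAt (CSpace m) x₀
    set ψ := chartAt (CSpace n) (f x₀)
    have hφ : φ ∈ atlas (CSpace m) M := chart_mem_atlas _ _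
    have hψ : ψ ∈ atlas (CSpace n) N := chart_mem_atlas _ _
    have hx₀ : x₀ ∈ φ.source := mem_chart_source _ _
    have hU : IsOpen (coordDomain φ ψ f) := isOpen_coordDomain hf.continuous
    have hx₀U : φ x₀ ∈ coordDomain φ ψ f := by
      refine ⟨φ.map_source hx₀, ?_⟩
      simp only [Set.mem_preimage, φ.left_inv hx₀]
      exact mem_chart_source _ _
    obtain ⟨r, hr, hrU⟩ := Metric.isOpen_iff.mp hU _ hx₀U
    have hconst := fun {y z : CSpace m} => Metric.isOpen_ball.is_const_of_fderiv_eq_zero (𝕜 := ℂ)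
      (x := y) (y := z)
      (f := ψ ∘ f ∘ φ.symm) (s := Metric.ball (φ x₀) r)
      (convex_ball (φ x₀) r).isPreconnected
      (fun y hy => (differentiableAt_coord hf hφ hψ (hrU hy)).differentiableWithinAt)
      (fun y hy => by
        ext1 v
        rw [fderiv_coord_apply hf hφ hψ (hrU hy), h0]
        simp)
    filter_upwards [φ.open_source.mem_nhds hx₀,
      (φ.continuousAt hx₀).preimage_mem_nhds (Metric.ball_mem_nhds _ hr)] with x hx hxr
    have h1 := hconst hxr (Metric.mem_ball_self hr)
    simp only [Function.comp_apply, φ.left_inv hx, φ.left_inv hx₀] at h1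
    refine ψ.injOn ?_ (mem_chart_source _ _) h1
    have := (hrU hxr).2
    simpa only [Set.mem_preimage, φ.left_inv hx] using this
  obtain ⟨x₀⟩ := (inferInstance : Nonempty M)
  exact ⟨f x₀, fun x => hloc.apply_eq_of_isPreconnected isPreconnected_univ trivial trivial⟩

end Constant

namespace HermitianMetric

variable {m n : ℕ} {M : Type*} [TopologicalSpace M] [ChartedSpace (CSpace m) M]
  [IsManifold 𝓘(ℂ, CSpace m) ω M]
  {N : Type*} [TopologicalSpace N] [ChartedSpace (CSpace n) N] [IsManifold 𝓘(ℂ, CSpace n) ω N]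
  {f : M → N}

/-- A non-constant holomorphic map from a compact connected Hermitian manifold compares the
curvatures in some direction and its image. -/
lemma exists_curvatureForm_le [CompactSpace M] [ConnectedSpace M]
    (g : HermitianMetric m M) (h : HermitianMetric n N)
    (hf : MDifferentiable 𝓘(ℂ, CSpace m) 𝓘(ℂ, CSpace n) f) (hne : ¬ ∃ c, ∀ x, f x = c) :
    ∃ (x : M) (v : CSpace m) (C : ℝ), 0 < C ∧ v ≠ 0 ∧ modelDeriv m n f x v ≠ 0 ∧
      C * (g.curvatureForm x v).re ≤ (h.curvatureForm (f x) (modelDeriv m n f x v)).re := by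
  have hd : ∃ x, modelDeriv m n f x ≠ 0 := by
    by_contra! h0
    exact hne (exists_forall_eq_of_modelDeriv_eq_zero hf h0)
  obtain ⟨x₁, hx₁⟩ := hd
  obtain ⟨v₁, hv₁⟩ : ∃ v, modelDeriv m n f x₁ v ≠ 0 := by
    by_contra! h0
    exact hx₁ (ContinuousLinearMap.ext h0)
  have hm : 0 < m := by
    rcases Nat.eq_zero_or_pos m with rfl | hm
    · exact absurd (by rw [Subsingleton.elim v₁ 0, map_zero]) hv₁
    · exact hm
  obtain ⟨x, v, hv, H⟩ := g.exists_max_distortion h hf hm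
  have hB := g.lenSq_pos x hv
  have hA : 0 < h.lenSq (f x) (modelDeriv m n f x v) := by
    by_contra! hA
    have h1 := mul_pos (h.lenSq_pos (f x₁) hv₁) hB
    have h2 := mul_nonpos_of_nonpos_of_nonneg hA (g.lenSq_nonneg x₁ v₁)
    linarith [H x₁ v₁]
  have hw : modelDeriv m n f x v ≠ 0 := by
    intro h0
    rw [h0, lenSq_zero] at hA
    exact hA.false
  refine ⟨x, v, _, div_pos hA hB, hv, hw, ?_⟩
  set φ := chartAt (CSpace m) x
  set ψ := chartAt (CSpace n) (f x)
  have hφ : φ ∈ atlas (CSpace m) M := chart_mem_atlas _ _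
  have hψ : ψ ∈ atlas (CSpace n) N := chart_mem_atlas _ _
  have hx : x ∈ φ.source := mem_chart_source _ _
  have hxU : φ x ∈ coordDomain φ ψ f := by
    refine ⟨φ.map_source hx, ?_⟩
    simp only [Set.mem_preimage, φ.left_inv hx]
    exact mem_chart_source _ _
  have key := g.coordCurvature_le_of_isMax h hφ hψ (F := ψ ∘ f ∘ φ.symm) (y₀ := φ x)
    (c := modelDeriv m m φ x v)
    (C := h.lenSq (f x) (modelDeriv m n f x v) / g.lenSq x v)
    (isOpen_coordDomain hf.continuous) Set.inter_subset_left
    (fun y hy => (differentiableAt_coord hf hφ hψ hy).differentiableWithinAt)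
    (fun y hy => ψ.map_source hy.2) hxU ?_ ?_
  · rw [fderiv_coord_apply hf hφ hψ hxU, modelDeriv_symm_apply hφ hx] at key
    simp only [Function.comp_apply, φ.left_inv hx] at key
    exact key
  · intro y hy u
    rw [h.re_coordForm_fderiv_coord hf hφ hψ hy, re_coordForm, div_mul_eq_mul_div,
      le_div_iff₀ hB]
    exact H _ _
  · rw [h.re_coordForm_fderiv_coord hf hφ hψ hxU, re_coordForm, modelDeriv_symm_apply hφ hx,
      φ.left_inv hx, div_mul_cancel₀ _ hB.ne']

end HermitianMetric

end

theorem corollary1p5 {m n : ℕ}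
    {M : Type*} [TopologicalSpace M] [T2Space M] [CompactSpace M] [ConnectedSpace M]
    [ChartedSpace (CSpace m) M] [IsManifold 𝓘(ℂ, CSpace m) ω M]
    {N : Type*} [TopologicalSpace N] [T2Space N]
    [ChartedSpace (CSpace n) N] [IsManifold 𝓘(ℂ, CSpace n) ω N]
    (g : HermitianMetric m M) (h : HermitianMetric n N)
    (f : M → N) (hf : MDifferentiable 𝓘(ℂ, CSpace m) 𝓘(ℂ, CSpace n) f) :
    (g.PosHSC → h.NonposHSC → ∃ c : N, ∀ x : M, f x = c) ∧
    (g.NonnegHSC → h.NegHSC → ∃ c : N, ∀ x : M, f x = c) := by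
  constructor
  · intro hg hh
    by_contra hne
    obtain ⟨x, v, C, hC, hv, hw, hle⟩ := g.exists_curvatureForm_le h hf hne
    have h1 := (div_pos_iff_of_pos_right (pow_pos (g.pos x v hv) 2)).mp (hg x v hv)
    have h2 := (div_le_iff₀ (pow_pos (h.pos (f x) _ hw) 2)).mp (hh (f x) _ hw)
    linarith [mul_pos hC h1]
  · intro hg hh
    by_contra hne
    obtain ⟨x, v, C, hC, hv, hw, hle⟩ := g.exists_curvatureForm_le h hf hne
    have h1 := (le_div_iff₀ (pow_pos (g.pos x v hv) 2)).mp (hg x v hv)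
    have h2 := (div_lt_iff₀ (pow_pos (h.pos (f x) _ hw) 2)).mp (hh (f x) _ hw)
    rw [zero_mul] at h1 h2
    linarith [mul_nonneg hC.le h1]
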